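/- **Network.** Let $K,F,Z,r,S,L,N\ge 1$ be integers with $r\le K$. A server with $L$ transmit antennas holds $N$ files of $B$ bits. There are $K$ caches, each able to store $M$ files ($MB$ bits), and $K$ users; user $k$ accesses the $r$ cyclically consecutive caches $k,k+1,\dots,k+r-1$ (indices modulo $K$). The placement depends neither on the users' demands $\mathbf d=(d_1,\dots,d_K)\in[N]^K$ nor on the channel. In each channel use the server sends $\mathbf x\in\mathbb C^L$ with $\mathbb E\|\mathbf x\|^2\le P$ and user $k$ receives $\mathbf h_k^{\mathrm T}\mathbf x+n_k$, where the $n_k$ are independent $\mathcal{CN}(0,1)$ noises. The channel vectors $\mathbf h_1,\dots,\mathbf h_K\in\mathbb C^L$ are constant during each transmission (they may change from one transmission to the next) and known to the server and the users. They are in *general position* if those of any at most $L$ users are linearly independent. The files are independent and uniformly distributed, $P_e$ is the maximum over $\mathbf d$ and $k$ of the probability that user $k$ does not recover file $d_k$, $T(\mathbf d)$ is the number of channel uses spent on demand $\mathbf d$, and the normalized delivery time is $$T_n=\lim_{P\to\infty}\ \lim_{B\to\infty}\ \frac{\max_{\mathbf d}T(\mathbf d)}{B/\log_2 P}.$$ **Arrays.**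 A $(K,F,Z,r)$ *caching array* is an $F\times K$ array $\mathbf C$ of stars and nulls in which every column has exactly $Z$ stars and any two distinct columns at cyclic distance less than $r$ have no star in a common row. A $(\mathbf C,S,L)$ *delivery array* is an $F\times K$ array $\mathbf D=[d_{j,k}]$ with entries in $\{\star\}\cup\{1,\dots,S\}$ such that: (D1) $d_{j,k}=\star$ if and only if one of the columns $k,k+1,\dots,k+r-1$ (modulo $K$) of $\mathbf C$ has a star in row $j$; (D2) every $s\in\{1,\dots,S\}$ occurs in $\mathbf D$, and at most once in each column; (D3) for every $s$, in the subarray of $\mathbf D$ formed by the rows and columns that contain $s$, every row has at most $L$ integer entries. **Lemma.** Let $\mathbf C$ be a $(K,F,Z,r)$ caching array, $\mathbf D$ a $(\mathbf C,S,L)$ delivery array, and $M/N=Z/F$. Then Lebesgue-almost every channel is in general position, and there is a coded caching scheme for the above network, defined for file sizes $B=Fb$ ($b\in\mathbb N$) and all powers $P$, with the following properties. 1. (Subpacketization level $F$.) Each file $W^n$ is split into $F$ subfiles $W^n_1,\dots,W^n_F$ of $b$ bits, and cache $i$ stores exactly the subfiles $W^n_j$, $n\in[N]$, for which row $j$ of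 column $i$ of $\mathbf C$ is a star; this respects the memory constraint. 2. (Zero-forcing delivery.) There are $S$ transmissions, one for each integer $s$ in $\mathbf D$. In transmission $s$ the server sends $\sum_{(j,k):\,d_{j,k}=s}\mathbf v^{(s)}_k\,\varphi(W^{d_k}_j)$, where $\varphi$ encodes a subfile as a block of complex symbols, one symbol per channel use. The block length does not depend on the demand. For channels in general position, if $d_{j,k}=s$ then $\mathbf h_k^{\mathrm T}\mathbf v^{(s)}_k\ne0$, and $\mathbf h_u^{\mathrm T}\mathbf v^{(s)}_k=0$ for every user $u\ne k$ whose column contains $s$ and for which $d_{j,u}\neq\star$. User $k$ reads $W^{d_k}_j$ from its accessible caches if $d_{j,k}=\star$, and otherwise decodes it from those caches and the single transmission $s=d_{j,k}$. 3. (Performance.) For all channel realizations in general position, the power constraint holds and $P_e\to0$ as $B\to\infty$ for every $P>0$, and the normalized delivery time is $T_n=S/F$. -/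

import Mathlib

open MeasureTheory ProbabilityTheory Filter Topology
open scoped ENNReal NNReal

namespace MACC

/-! ### Cyclic indexing. Caches, users, subfiles and integers are numbered from `0`. -/

/-- The residue of `a` modulo `K` taken in `{1, …, K}`. -/
def cyc (K : ℕ) (a : ℤ) : ℤ := if a % (K : ℤ) = 0 then (K : ℤ) else a % (K : ℤ)

/-- The `r` cyclically consecutive caches `k, k + 1, …, k + r - 1` accessed by user `k`. -/
def access (K r : ℕ) (k : Fin K) : Set (Fin K) :=
  {i | ∃ m < r, (i : ℕ) = ((k : ℕ) + m) % K}

/-! ### Caching and delivery arrays -/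

/-- The rows in which column `k` of `C` has a star (`true` is a star, `false` is a null). -/
def starRows {F K : ℕ} (C : Fin F → Fin K → Bool) (k : Fin K) : Finset (Fin F) :=
  Finset.univ.filter fun j => C j k = true

/-- `C` is a `(K, F, Z, r)` caching array. -/
structure IsCachingArray {F K : ℕ} (Z r : ℕ) (C : Fin F → Fin K → Bool) : Prop where
  card_star : ∀ k, (starRows C k).card = Z
  disjoint : ∀ k₁ k₂ : Fin K, k₁ ≠ k₂ →
    (cyc K ((k₁ : ℤ) - (k₂ : ℤ)) < r ∨ cyc K ((k₂ : ℤ) - (k₁ : ℤ)) < r) →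
    Disjoint (starRows C k₁) (starRows C k₂)

/-- `D` is a `(C, S, L)` delivery array (`none` is a star, `some s` is the integer `s`). -/
structure IsDeliveryArray {F K S : ℕ} (r L : ℕ) (C : Fin F → Fin K → Bool)
    (D : Fin F → Fin K → Option (Fin S)) : Prop where
  star_iff : ∀ j k, D j k = none ↔ ∃ i ∈ access K r k, j ∈ starRows C i
  occurs : ∀ s, ∃ j k, D j k = some s
  once : ∀ s k j j', D j k = some s → D j' k = some s → j = j'
  row_le : ∀ s j, (∃ k, D j k = some s) →
    (Finset.univ.filter fun k => (∃ j', D j' k = some s) ∧ D j k ≠ none).card ≤ L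

/-! ### The network: files, demands, channel, noise -/

/-- A file of `B` bits. -/
abbrev File (B : ℕ) := Fin B → Bool

/-- A library of `N` files of `B` bits. -/
abbrev Library (N B : ℕ) := Fin N → File B

/-- A demand vector: user `k` wants file `d k`. -/
abbrev Demand (K N : ℕ) := Fin K → Fin N

/-- The channel vectors `h k ∈ ℂ^L` of all the users during one transmission. -/
abbrev Channel (K L : ℕ) := Fin K → Fin L → ℂ

/-- The channel is in general position: any at most `L` users have linearly independent
channel vectors. -/
def GeneralPosition {K L : ℕ} (h : Channel K L) : Prop :=
  ∀ U : Finset (Fin K), U.card ≤ L → LinearIndependent ℂ fun u : U => h u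

/-- The circularly symmetric complex Gaussian law with mean `0` and variance `1`. -/
noncomputable def complexGaussian : Measure ℂ :=
  ((gaussianReal 0 (1 / 2)).prod (gaussianReal 0 (1 / 2))).map fun p => (⟨p.1, p.2⟩ : ℂ)

/-- A coded caching scheme for the network with `K` users and `K` caches, each user
accessing `r` cyclically consecutive caches, `L` transmit antennas, `N` files of `B` bits and
`S` transmissions. Transmission `s` occupies `len h d s` channel uses, during which the
channel is constant and equal to `h`. The placement knows neither the demand nor the channel;
a transmission is designed from the library, the demand and its channel; a user decodes from
the caches that it accesses and its received signals, knowing the channels and the demand. -/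
structure Scheme (K r L N B S : ℕ) where
  Content : Fin K → Type
  place : ∀ i, Library N B → Content i
  len : Channel K L → Demand K N → Fin S → ℕ
  transmit : ∀ (h : Channel K L) (d : Demand K N) (s : Fin S),
    Library N B → Fin (len h d s) → Fin L → ℂ
  decode : ∀ (H : Fin S → Channel K L) (d : Demand K N) (k : Fin K),
    (∀ i : access K r k, Content i) → (∀ s, Fin (len (H s) d s) → ℂ) → File B
  measurable_decode : ∀ H d k c, Measurable (decode H d k c)

namespace Scheme

variable {K r L N B S : ℕ}

/-- Each cache holds at most `M` files, that is, `M * B` bits. -/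
def MeetsMemory (σ : Scheme K r L N B S) (M : ℝ) : Prop :=
  ∀ i, Real.logb 2 ((Set.range (σ.place i)).ncard : ℝ) ≤ M * B

/-- In every channel use the transmitted vector `x` satisfies `E[‖x‖²] ≤ P`, the library
being uniformly distributed. -/
def MeetsPower (σ : Scheme K r L N B S) (P : ℝ) (H : Fin S → Channel K L) : Prop :=
  ∀ (d : Demand K N) (s : Fin S) (t : Fin (σ.len (H s) d s)),
    (∑ W : Library N B, ∑ a : Fin L, ‖σ.transmit (H s) d s W t a‖ ^ 2)
      / (Fintype.card (Library N B) : ℝ) ≤ P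

/-- What user `k` receives, `y = hᵀ x + ν`, when the noise is `ν`. -/
noncomputable def received (σ : Scheme K r L N B S) (H : Fin S → Channel K L) (d : Demand K N)
    (k : Fin K) (W : Library N B) (ν : ∀ s, Fin (σ.len (H s) d s) → ℂ) :
    ∀ s, Fin (σ.len (H s) d s) → ℂ :=
  fun s t => H s k ⬝ᵥ σ.transmit (H s) d s W t + ν s t

/-- The probability that user `k` does not recover its file under demand `d`, for a uniformly
distributed library and independent unit-variance complex Gaussian noise. -/
noncomputable def userError (σ : Scheme K r L N B S) (H : Fin S → Channel K L)
    (d : Demand K N) (k : Fin K) : ℝ≥0∞ :=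
  (∑ W : Library N B,
    (Measure.pi fun s => Measure.pi fun _ : Fin (σ.len (H s) d s) => complexGaussian)
      {ν | σ.decode H d k (fun i => σ.place i W) (σ.received H d k W ν) ≠ W (d k)})
    / (Fintype.card (Library N B) : ℝ≥0∞)

/-- The worst-case probability of error. -/
noncomputable def errorProb (σ : Scheme K r L N B S) (H : Fin S → Channel K L) : ℝ≥0∞ :=
  ⨆ (d : Demand K N) (k : Fin K), σ.userError H d k

/-- The worst-case delivery time, in channel uses. -/
def deliveryTime (σ : Scheme K r L N B S) (H : Fin S → Channel K L) : ℕ :=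
  Finset.univ.sup fun d : Demand K N => ∑ s, σ.len (H s) d s

end Scheme

/-- The schemes `σ P b`, for power `P` and files of `B = F * b` bits, have normalized delivery
time `τ` for the channel realization `H`: the iterated limit, first `b → ∞`, then `P → ∞`, of
`deliveryTime / (B / log₂ P)` exists and equals `τ`. -/
def HasNDT {K r L N F S : ℕ} (σ : ℝ → ∀ b : ℕ, Scheme K r L N (F * b) S)
    (H : Fin S → Channel K L) (τ : ℝ) : Prop :=
  ∃ g : ℝ → ℝ,
    (∀ᶠ P in atTop, Tendsto
      (fun b : ℕ => ((σ P b).deliveryTime H : ℝ) / (((F * b : ℕ) : ℝ) / Real.logb 2 P))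
      atTop (𝓝 (g P))) ∧
    Tendsto g atTop (𝓝 τ)

/-! ### The scheme of a pair of arrays -/

/-- Subfile `j` of a file that is split into `F` subfiles of `b` bits. -/
def subfile {F b : ℕ} (w : File (F * b)) (j : Fin F) : Fin b → Bool :=
  fun q => w (finProdFinEquiv (j, q))

/-- The content of cache `i`: the subfiles `W^n_j` for all files `n` and all rows `j` with a
star in column `i`. -/
abbrev CacheContent {F K : ℕ} (C : Fin F → Fin K → Bool) (N b : ℕ) (i : Fin K) : Type :=
  Fin N → starRows C i → Fin b → Bool

/-- What user `k` reads in the caches that it accesses. -/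
abbrev UserView {F K : ℕ} (r : ℕ) (C : Fin F → Fin K → Bool) (N b : ℕ) (k : Fin K) : Type :=
  ∀ i : access K r k, CacheContent C N b i

open Classical in
/-- Subfile `j` of file `n`, read in an accessible cache that holds it (a default value if
there is none). -/
noncomputable def readCache {F K r : ℕ} {C : Fin F → Fin K → Bool} {N b : ℕ} {k : Fin K}
    (c : UserView r C N b k) (n : Fin N) (j : Fin F) : Fin b → Bool :=
  if hj : ∃ i : access K r k, j ∈ starRows C i then c hj.choose n ⟨j, hj.choose_spec⟩
  else fun _ => false

/-- Zero-forcing precoders. For an integer `s` that stands in row `j` and column `k` of `D`,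
the vector `v h s k` carries the subfile `j` wanted by user `k`: it is orthogonal (without
conjugation) to the channel vector of every other user `u` that is served by `s` and does not
have subfile `j`, and not orthogonal to that of user `k`. -/
def IsZeroForcing {F K S L : ℕ} (D : Fin F → Fin K → Option (Fin S))
    (v : Channel K L → Fin S → Fin K → Fin L → ℂ) : Prop :=
  ∀ h : Channel K L, GeneralPosition h → ∀ s j k, D j k = some s →
    (∀ u, u ≠ k → (∃ j', D j' u = some s) → D j u ≠ none → h u ⬝ᵥ v h s k = 0) ∧
    h k ⬝ᵥ v h s k ≠ 0

/-- A code for subfiles of `b` bits: for the channel `h`, every subfile is encoded as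
`len h` complex symbols by one encoder; `est h d s k` is the estimate that user `k` makes of
the subfile sent to it in transmission `s`, from the caches that it accesses and the signal
that it receives in that single transmission. -/
structure SubfileCode {F K : ℕ} (r L S : ℕ) (C : Fin F → Fin K → Bool) (N b : ℕ) where
  len : Channel K L → ℕ
  enc : ∀ h : Channel K L, (Fin b → Bool) → Fin (len h) → ℂ
  est : ∀ (h : Channel K L) (_ : Demand K N) (_ : Fin S) (k : Fin K),
    UserView r C N b k → (Fin (len h) → ℂ) → Fin b → Bool
  measurable_est : ∀ h d s k c, Measurable (est h d s k c)

/-- The scheme given by the arrays `C` and `D`, the precoders `v` and the subfile code `m`.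
Cache `i` stores the subfiles marked by the stars of column `i` of `C`; transmission `s` sends
the sum of the encoded subfiles `W^{d k}_j`, precoded by `v h s k`, over the entries
`D j k = s`; user `k` reads the subfiles marked by the stars of column `k` of `D` in its
caches, and estimates every other subfile `j` from the one transmission `s = D j k`. -/
noncomputable def arrayScheme {F K S r L N b : ℕ} (C : Fin F → Fin K → Bool)
    (D : Fin F → Fin K → Option (Fin S)) (v : Channel K L → Fin S → Fin K → Fin L → ℂ)
    (m : SubfileCode r L S C N b) : Scheme K r L N (F * b) S where
  Content := CacheContent C N b
  place := fun _ W n j => subfile (W n) j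
  len := fun h _ _ => m.len h
  transmit := fun h d s W t =>
    ∑ k, ∑ j, if D j k = some s then m.enc h (subfile (W (d k)) j) t • v h s k else 0
  decode := fun H d k c y p =>
    match D (finProdFinEquiv.symm p).1 k with
    | none => readCache c (d k) (finProdFinEquiv.symm p).1 (finProdFinEquiv.symm p).2
    | some s => m.est (H s) d s k c (y s) (finProdFinEquiv.symm p).2
  measurable_decode := by
    intro H d k c
    refine measurable_pi_lambda _ fun p => ?_
    cases hD : D (finProdFinEquiv.symm p).1 k with
    | none => exact measurable_const
    | some s =>
      exact (measurable_pi_apply _).comp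
        ((m.measurable_est (H s) d s k c).comp (measurable_pi_apply s))

end MACC

open MACC

namespace MACC

/-! ### Almost every channel is in general position -/

/-! Let the entry in row j and column k of `D` be s. By (D3) at most L users served by s lack
subfile j; in general position their channel vectors are independent, so some precoder has product 1
with that of user k and 0 with the others. In transmission s user k then receives its one wanted
codeword (D2) with unit gain, plus codewords of subfiles that (D1) places in its caches. Subtracting
these (`dotProduct_transmit`) leaves a point-to-point complex Gaussian channel.

On that channel a rate log₂ P + O(1) is enough, because the normalized delivery time sees only the
leading term. `nonempty_packingCode` packs codewords greedily in a polydisc of peak power A, the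
noise being confined to a ball by Chebyshev, and reaches the rate log₂(A/(8e)). At low power a
repetition code is reliable; its vanishing rate is harmless since P → ∞ in the limit. The power
constraint costs a channel-dependent factor, also lost in the logarithm. Each of the S transmissions
thus takes about b / log₂ P uses for b = B/F bits, whence S/F.

General position is generic because a further channel vector destroys independence only by falling
into a proper subspace. -/

lemma measurableSet_linearIndepOn {K L : ℕ} (U : Finset (Fin K)) :
    MeasurableSet {h : Channel K L | LinearIndepOn ℂ h (U : Set (Fin K))} := by
  have hO : IsOpen {f : ↥(U : Set (Fin K)) → Fin L → ℂ | LinearIndependent ℂ f} :=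
    isOpen_setOfPred_linearIndependent
  have hc : Continuous fun (h : Channel K L) (u : (U : Set (Fin K))) => h u := by fun_prop
  exact hc.measurable hO.measurableSet

lemma volume_span_eq_zero {K L : ℕ} (h : Channel K L) (U : Finset (Fin K)) (hU : U.card < L) :
    volume (Submodule.span ℂ (h '' U) : Set (Fin L → ℂ)) = 0 := by
  have hne : Submodule.span ℂ (h '' U) ≠ ⊤ := by
    intro htop
    have h1 := finrank_span_finset_le_card (R := ℂ) (U.image h)
    rw [Finset.coe_image, Set.finrank, htop] at h1
    have h3 : Module.finrank ℂ (⊤ : Submodule ℂ (Fin L → ℂ)) = L := by simp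
    have h4 := Finset.card_image_le (s := U) (f := h)
    omega
  -- Lebesgue measure is Haar for the real structure, so the proper complex subspace is viewed over
  -- ℝ.
  have := Measure.addHaar_submodule (volume : Measure (Fin L → ℂ))
    ((Submodule.span ℂ (h '' U)).restrictScalars ℝ) (by simpa using hne)
  simpa using this

/-- Induction on `U` and Fubini: with the other vectors fixed, independence is lost on adding `u`
only if `h u` lies in a span of fewer than `L` vectors, a null set. -/
lemma ae_linearIndepOn {K L : ℕ} (U : Finset (Fin K)) (hU : U.card ≤ L) :
    ∀ᵐ h : Channel K L, LinearIndepOn ℂ h (U : Set (Fin K)) := by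
  induction U using Finset.induction_on with
  | empty => simp [linearIndepOn_empty]
  | insert u U hu ih =>
    rw [Finset.card_insert_of_notMem hu] at hU
    set B : Set (Channel K L) := {h | LinearIndepOn ℂ h (U : Set (Fin K))} \
      {h | LinearIndepOn ℂ h ((insert u U : Finset (Fin K)) : Set (Fin K))} with hB
    have hBm : MeasurableSet B :=
      (measurableSet_linearIndepOn U).diff (measurableSet_linearIndepOn _)
    have hB0 : volume B = 0 := by
      rw [← lintegral_indicator_one hBm, volume_pi]
      rw [← lintegral_zero (μ := Measure.pi fun _ : Fin K => (volume : Measure (Fin L → ℂ)))]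
      -- It suffices that the indicator integrates to 0 over coordinate `u` alone, for any fixed
      -- values of the others.
      refine lintegral_eq_of_lmarginal_eq {u} (measurable_one.indicator hBm) measurable_const ?_
      funext h
      rw [lmarginal_singleton, lmarginal_singleton, lintegral_zero]
      refine lintegral_eq_zero_of_ae_eq_zero ?_
      have h0 := volume_span_eq_zero h U (by omega)
      refine (measure_eq_zero_iff_ae_notMem.1 h0).mono fun y hy => ?_
      refine Set.indicator_of_notMem (fun hmem => hmem.2 ?_) _
      have himg : Function.update h u y '' U = h '' U :=
        Set.image_congr fun x hx => Function.update_of_ne (by rintro rfl; exact hu hx) _ _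
      simp only [Set.mem_ofPred_eq, Finset.coe_insert]
      rw [linearIndepOn_insert (by simpa using hu)]
      refine ⟨hmem.1, ?_⟩
      rw [himg, Function.update_self]
      exact hy
    filter_upwards [ih (by omega), measure_eq_zero_iff_ae_notMem.1 hB0] with h h1 h2
    by_contra h3
    exact h2 ⟨h1, h3⟩

lemma ae_generalPosition (K L : ℕ) : ∀ᵐ h : Channel K L, GeneralPosition h := by
  have : ∀ᵐ h : Channel K L, ∀ U : Finset (Fin K), U.card ≤ L →
      LinearIndepOn ℂ h (U : Set (Fin K)) :=
    ae_all_iff.2 fun U => by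
      by_cases hU : U.card ≤ L
      · exact (ae_linearIndepOn U hU).mono fun h hh _ => hh
      · exact Eventually.of_forall fun h hh => absurd hh hU
  exact this.mono fun h hh U hU => hh U hU

/-! ### Zero-forcing precoders -/

/-- Independent rows give a matrix of full row rank, hence a surjective map; `x` is a preimage of a
unit vector. -/
lemma exists_dotProduct_eq_single {K L : ℕ} {h : Channel K L} {U : Finset (Fin K)}
    (hU : LinearIndependent ℂ fun u : U => h u) {k : Fin K} (hk : k ∈ U) :
    ∃ x : Fin L → ℂ, h k ⬝ᵥ x = 1 ∧ ∀ u ∈ U, u ≠ k → h u ⬝ᵥ x = 0 := by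
  classical
  let A : Matrix U (Fin L) ℂ := fun u => h u
  have hs : Function.Surjective A.mulVec := by
    have hr : A.rank = Fintype.card U := LinearIndependent.rank_matrix (M := A) hU
    have : LinearMap.range A.mulVecLin = ⊤ := by
      apply Submodule.eq_top_of_finrank_eq
      rw [← Matrix.rank, hr, Module.finrank_fintype_fun_eq_card]
    exact LinearMap.range_eq_top.1 this
  obtain ⟨x, hx⟩ := hs (Pi.single ⟨k, hk⟩ 1)
  refine ⟨x, (congrFun hx ⟨k, hk⟩).trans (Pi.single_eq_same _ _), fun u hu huk => ?_⟩
  have := congrFun hx ⟨u, hu⟩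
  rwa [Pi.single_eq_of_ne (by simpa using huk)] at this

/-- Zero-forcing precoders can be chosen with all the effective gains equal to `1`. -/
lemma exists_unit_gain_precoder {K F S r L : ℕ} {C : Fin F → Fin K → Bool}
    {D : Fin F → Fin K → Option (Fin S)} (hD : IsDeliveryArray r L C D) :
    ∃ v : Channel K L → Fin S → Fin K → Fin L → ℂ, ∀ h, GeneralPosition h →
      ∀ s j k, D j k = some s → h k ⬝ᵥ v h s k = 1 ∧
        ∀ u, u ≠ k → (∃ j', D j' u = some s) → D j u ≠ none → h u ⬝ᵥ v h s k = 0 := by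
  have key : ∀ h s k, ∃ x : Fin L → ℂ, GeneralPosition h → ∀ j, D j k = some s →
      h k ⬝ᵥ x = 1 ∧ ∀ u, u ≠ k → (∃ j', D j' u = some s) → D j u ≠ none →
        h u ⬝ᵥ x = 0 := by
    intro h s k
    by_cases hh : GeneralPosition h ∧ ∃ j, D j k = some s
    · obtain ⟨hg, j, hj⟩ := hh
      -- The set is that of the users served by `s` that lack subfile `j`: it contains `k`, and (D3)
      -- bounds it by `L`.
      obtain ⟨x, hx, hx'⟩ := exists_dotProduct_eq_single (hg _ (hD.row_le s j ⟨k, hj⟩)) (k := k)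
        (Finset.mem_filter.2 ⟨Finset.mem_univ _, ⟨j, hj⟩, by simp [hj]⟩)
      refine ⟨x, fun _ j₁ hj₁ => ?_⟩
      obtain rfl := hD.once s k j j₁ hj hj₁
      exact ⟨hx, fun u hu h1 h2 =>
        hx' u (Finset.mem_filter.2 ⟨Finset.mem_univ _, h1, h2⟩) hu⟩
    · exact ⟨0, fun hg j hj => absurd ⟨hg, j, hj⟩ hh⟩
  choose v hv using key
  exact ⟨v, fun h hg s j k hj => hv h s k hg j hj⟩

/-! ### Complex Gaussian noise -/

lemma measurable_complexMk : Measurable fun p : ℝ × ℝ => (⟨p.1, p.2⟩ : ℂ) :=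
  Complex.measurableEquivRealProd.symm.measurable

instance : IsProbabilityMeasure complexGaussian :=
  Measure.isProbabilityMeasure_map measurable_complexMk.aemeasurable

lemma measurePreserving_re :
    MeasurePreserving Complex.re complexGaussian (gaussianReal 0 (1 / 2)) := by
  refine ⟨Complex.measurable_re, ?_⟩
  rw [complexGaussian, Measure.map_map Complex.measurable_re measurable_complexMk]
  exact (measurePreserving_fst (μ := gaussianReal 0 (1 / 2)) (ν := gaussianReal 0 (1 / 2))).map_eq

lemma measurePreserving_im :
    MeasurePreserving Complex.im complexGaussian (gaussianReal 0 (1 / 2)) := by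
  refine ⟨Complex.measurable_im, ?_⟩
  rw [complexGaussian, Measure.map_map Complex.measurable_im measurable_complexMk]
  exact (measurePreserving_snd (μ := gaussianReal 0 (1 / 2)) (ν := gaussianReal 0 (1 / 2))).map_eq

lemma memLp_re : MemLp Complex.re 2 complexGaussian :=
  (memLp_id_gaussianReal 2).comp_measurePreserving measurePreserving_re

lemma integral_re : ∫ z, z.re ∂complexGaussian = 0 := by
  have := measurePreserving_re.map_eq
  rw [← integral_id_gaussianReal (μ := 0) (v := 1 / 2), ← this,
    integral_map Complex.measurable_re.aemeasurable (by fun_prop)]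

lemma variance_re : Var[Complex.re; complexGaussian] = 1 / 2 := by
  have := variance_id_gaussianReal (μ := 0) (v := 1 / 2)
  rw [← measurePreserving_re.map_eq,
    variance_map (by fun_prop) Complex.measurable_re.aemeasurable] at this
  simpa using this

lemma memLp_sq_gaussianReal (v : ℝ≥0) : MemLp (fun x : ℝ => x ^ 2) 2 (gaussianReal 0 v) := by
  have h4 : MemLp (id : ℝ → ℝ) 4 (gaussianReal 0 v) := memLp_id_gaussianReal 4
  rw [memLp_two_iff_integrable_sq (by fun_prop)]
  have := h4.integrable_norm_pow (p := 4) (by norm_num)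
  refine this.congr (Eventually.of_forall fun x => ?_)
  simp only [id, Real.norm_eq_abs]
  rw [← pow_mul, ← abs_pow, abs_of_nonneg (by positivity)]

lemma integral_sq_gaussianReal (v : ℝ≥0) : ∫ x, x ^ 2 ∂gaussianReal 0 v = v := by
  have h := variance_id_gaussianReal (μ := 0) (v := v)
  rw [variance_eq_sub (memLp_id_gaussianReal 2)] at h
  simpa using h

/-- Finite fourth moments of the noise, so that Chebyshev applies to its energy. -/
lemma memLp_norm_sq : MemLp (fun z : ℂ => ‖z‖ ^ 2) 2 complexGaussian := by
  have h1 := (memLp_sq_gaussianReal (1 / 2)).comp_measurePreserving measurePreserving_re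
  have h2 := (memLp_sq_gaussianReal (1 / 2)).comp_measurePreserving measurePreserving_im
  refine (h1.add h2).ae_eq (Eventually.of_forall fun z => ?_)
  simp only [Pi.add_apply, Function.comp_apply, Complex.sq_norm, Complex.normSq_apply]
  ring

lemma integral_norm_sq : ∫ z, ‖z‖ ^ 2 ∂complexGaussian = 1 := by
  have h1 := (memLp_sq_gaussianReal (1 / 2)).comp_measurePreserving measurePreserving_re
  have h2 := (memLp_sq_gaussianReal (1 / 2)).comp_measurePreserving measurePreserving_im
  have e1 : ∫ z, z.re ^ 2 ∂complexGaussian = 1 / 2 := by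
    have := integral_sq_gaussianReal (1 / 2)
    rw [← measurePreserving_re.map_eq,
      integral_map Complex.measurable_re.aemeasurable (by fun_prop)] at this
    simpa using this
  have e2 : ∫ z, z.im ^ 2 ∂complexGaussian = 1 / 2 := by
    have := integral_sq_gaussianReal (1 / 2)
    rw [← measurePreserving_im.map_eq,
      integral_map Complex.measurable_im.aemeasurable (by fun_prop)] at this
    simpa using this
  have : (fun z : ℂ => ‖z‖ ^ 2) = fun z => z.re ^ 2 + z.im ^ 2 := by
    funext z
    rw [Complex.sq_norm, Complex.normSq_apply]; ring
  have hadd := integral_add (h1.integrable (by norm_num)) (h2.integrable (by norm_num))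
  simp only [Function.comp_apply] at hadd
  rw [this, hadd, e1, e2]
  norm_num

/-- Chebyshev's inequality for a sum of functions of the independent noise symbols. -/
lemma gaussian_chebyshev {n : ℕ} {X : Fin n → ℂ → ℝ} (hX : ∀ i, MemLp (X i) 2 complexGaussian)
    {μ V c : ℝ} (hμ : ∑ i, ∫ z, X i z ∂complexGaussian = μ)
    (hV : ∑ i, Var[X i; complexGaussian] ≤ V) (hc : 0 < c) :
    (Measure.pi fun _ : Fin n => complexGaussian) {ν | c ≤ |∑ i, X i (ν i) - μ|}
      ≤ ENNReal.ofReal (V / c ^ 2) := by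
  have hmem : ∀ i, MemLp (fun ν : Fin n → ℂ => X i (ν i)) 2
      (Measure.pi fun _ : Fin n => complexGaussian) := fun i =>
    (hX i).comp_measurePreserving (measurePreserving_eval _ i)
  have hsum : MemLp (∑ i, fun ν : Fin n → ℂ => X i (ν i)) 2
      (Measure.pi fun _ : Fin n => complexGaussian) := memLp_finsetSum' _ fun i _ => hmem i
  have hint : ∫ ν, (∑ i, fun ν : Fin n → ℂ => X i (ν i)) ν
      ∂(Measure.pi fun _ : Fin n => complexGaussian) = μ := by
    simp only [Finset.sum_apply]
    rw [integral_finsetSum _ fun i _ => (hmem i).integrable (by norm_num), ← hμ]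
    exact Finset.sum_congr rfl fun i _ => integral_comp_eval (μ := fun _ : Fin n => complexGaussian)
      (hX i).aestronglyMeasurable
  have h := meas_ge_le_variance_div_sq hsum hc
  rw [hint, variance_sum_pi hX] at h
  simp only [Finset.sum_apply] at h
  exact h.trans (ENNReal.ofReal_le_ofReal (by gcongr))

/-! ### Codes for the point-to-point complex Gaussian channel -/

/-- A decoder for the channel `y = c w + ν` that never fails when the noise lies in `G`, if the
translates `c w + G` are disjoint. -/
lemma exists_decoder {b n : ℕ} (c : (Fin b → Bool) → Fin n → ℂ) {G : Set (Fin n → ℂ)}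
    (hG : MeasurableSet G)
    (hdisj : ∀ w w', ∀ ν ∈ G, ∀ ν' ∈ G, c w + ν = c w' + ν' → w = w') :
    ∃ dec : (Fin n → ℂ) → Fin b → Bool, Measurable dec ∧ ∀ w, ∀ ν ∈ G, dec (c w + ν) = w := by
  classical
  -- Bit `q` is read as true when some message with that bit true explains `y` by a noise in `G`.
  -- Deciding bit by bit makes measurability a finite union of translates of `G`.
  refine ⟨fun y q => decide (∃ w, w q = true ∧ y - c w ∈ G), ?_, ?_⟩
  · refine measurable_pi_lambda _ fun q => measurable_to_bool ?_
    have : (fun y => decide (∃ w, w q = true ∧ y - c w ∈ G)) ⁻¹' {true} =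
        ⋃ w : Fin b → Bool, ⋃ _ : w q = true, (fun y => y - c w) ⁻¹' G := by
      ext y; simp
    rw [this]
    exact MeasurableSet.iUnion fun w => MeasurableSet.iUnion fun _ =>
      (measurable_id.sub_const (c w)) hG
  · intro w ν hν
    funext q
    have : (∃ w', w' q = true ∧ c w + ν - c w' ∈ G) ↔ w q = true := by
      constructor
      · rintro ⟨w', hq, hw'⟩
        rwa [hdisj w w' ν hν _ hw' (by abel)]
      · exact fun hq => ⟨w, hq, by simpa using hν⟩
    simp [this]

/-- A code that conveys `b` bits in `n` complex symbols, each of squared modulus at most `A`,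
such that every message is misdetected with probability at most `δ` in unit-variance noise. -/
structure GaussianCode (b n : ℕ) (A : ℝ) (δ : ℝ≥0∞) where
  enc : (Fin b → Bool) → Fin n → ℂ
  dec : (Fin n → ℂ) → Fin b → Bool
  measurable_dec : Measurable dec
  norm_sq_le : ∀ w t, ‖enc w t‖ ^ 2 ≤ A
  error_le : ∀ w, (Measure.pi fun _ : Fin n => complexGaussian)
    {ν | dec (enc w + ν) ≠ w} ≤ δ

lemma nonempty_gaussianCode {b n : ℕ} {A : ℝ} {δ : ℝ≥0∞} (c : (Fin b → Bool) → Fin n → ℂ)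
    (hc : ∀ w t, ‖c w t‖ ^ 2 ≤ A) {G : Set (Fin n → ℂ)} (hG : MeasurableSet G)
    (hδ : (Measure.pi fun _ : Fin n => complexGaussian) Gᶜ ≤ δ)
    (hdisj : ∀ w w', ∀ ν ∈ G, ∀ ν' ∈ G, c w + ν = c w' + ν' → w = w') :
    Nonempty (GaussianCode b n A δ) := by
  obtain ⟨dec, hm, hdec⟩ := exists_decoder c hG hdisj
  exact ⟨⟨c, dec, hm, hc, fun w => (measure_mono fun ν (hν : dec (c w + ν) ≠ w) hG => hν (hdec w ν hG)).trans hδ⟩⟩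

/-- Sending every bit `m` times. -/
lemma nonempty_repetitionCode {A : ℝ} (hA : 0 < A) (b : ℕ) {m : ℕ} (hm : 0 < m) :
    Nonempty (GaussianCode b (b * m) A (b * ENNReal.ofReal (1 / (2 * m * A)))) := by
  classical
  set c : (Fin b → Bool) → Fin (b * m) → ℂ := fun w t =>
    ((if w (finProdFinEquiv.symm t).1 then √A else -√A : ℝ) : ℂ) with hc
  set X : Fin b → Fin (b * m) → ℂ → ℝ := fun q t z =>
    if (finProdFinEquiv.symm t).1 = q then z.re else 0 with hX
  have hsA : 0 < √A := Real.sqrt_pos.2 hA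
  have hm' : (0 : ℝ) < m := by exact_mod_cast hm
  have hcount : ∀ (q : Fin b) (x : ℝ),
      ∑ t : Fin (b * m), (if (finProdFinEquiv.symm t).1 = q then x else 0) = m * x := by
    intro q x
    rw [← finProdFinEquiv.sum_comp, Fintype.sum_prod_type]
    simp [Finset.sum_ite_eq']
  have hXm : ∀ q t, Measurable (X q t) := fun q t => by
    simp only [hX]; split_ifs
    · exact Complex.measurable_re
    · exact measurable_const
  -- For each bit, the real noise summed over its `m` copies stays below `m√A`, half the distance
  -- between the two noiseless sums.
  set G : Set (Fin (b * m) → ℂ) := ⋂ q, {ν | m * √A ≤ |∑ t, X q t (ν t) - 0|}ᶜ with hG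
  refine nonempty_gaussianCode c (fun w t => ?_) (G := G) ?_ ?_ ?_
  · simp only [hc, Complex.norm_real, Real.norm_eq_abs, sq_abs]
    split_ifs <;> simp [Real.sq_sqrt hA.le]
  · refine MeasurableSet.iInter fun q => MeasurableSet.compl ?_
    refine measurableSet_le measurable_const ?_
    have : Measurable fun ν : Fin (b * m) → ℂ => ∑ t, X q t (ν t) :=
      Finset.measurable_sum _ fun t _ => (hXm q t).comp (measurable_pi_apply t)
    exact (this.sub_const 0).abs
  · rw [hG, Set.compl_iInter]
    simp only [compl_compl]
    refine (measure_iUnion_fintype_le _ _).trans ?_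
    have hb : (b : ℝ≥0∞) * ENNReal.ofReal (1 / (2 * m * A)) =
        ∑ _q : Fin b, ENNReal.ofReal (1 / (2 * m * A)) := by simp
    rw [hb]
    refine Finset.sum_le_sum fun q _ => ?_
    -- Each real part has variance 1/2, so the bound is (m/2)/(m√A)² = 1/(2mA).
    have := gaussian_chebyshev (X := X q) (μ := 0) (V := m * (1 / 2)) (c := m * √A) ?_ ?_ ?_
      (by positivity)
    · refine this.trans (ENNReal.ofReal_le_ofReal (le_of_eq ?_))
      rw [mul_pow, Real.sq_sqrt hA.le]
      field_simp
    · intro t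
      simp only [hX]; split_ifs
      · exact memLp_re
      · exact MemLp.zero
    · refine Finset.sum_eq_zero fun t _ => ?_
      simp only [hX]; split_ifs
      · exact integral_re
      · simp
    · rw [← hcount q]
      refine Finset.sum_le_sum fun t _ => ?_
      simp only [hX]; split_ifs
      · exact variance_re.le
      · exact (variance_zero complexGaussian).le
  · intro w w' ν hν ν' hν' heq
    have key : ∀ w w' : Fin b → Bool, ∀ ν ∈ G, ∀ ν' ∈ G, c w + ν = c w' + ν' →
        ∀ q, w q = true → w' q = true := by
      intro w w' ν hν ν' hν' heq q hq
      by_contra hq'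
      have h1 := Set.mem_iInter.1 hν q
      have h2 := Set.mem_iInter.1 hν' q
      simp only [sub_zero, Set.mem_compl_iff, Set.mem_ofPred_eq, not_le, abs_lt] at h1 h2
      -- Summed over the copies of bit `q`, the equal real parts give a positive left side and a
      -- negative right side.
      have h3 : ∀ t, (if (finProdFinEquiv.symm t).1 = q then √A else 0) + X q t (ν t) =
          (if (finProdFinEquiv.symm t).1 = q then -√A else 0) + X q t (ν' t) := by
        intro t
        have ht := congrArg Complex.re (congrFun heq t)
        simp only [hX]
        split_ifs with htq
        · simpa only [hc, Pi.add_apply, Complex.add_re, Complex.ofReal_re, htq, hq, hq',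
            if_true, if_false, Bool.false_eq_true] using ht
        · rfl
      have h4 := Finset.sum_congr rfl fun t (_ : t ∈ Finset.univ) => h3 t
      rw [Finset.sum_add_distrib, Finset.sum_add_distrib, hcount, hcount] at h4
      linarith [h1.1, h2.2]
    funext q
    exact Bool.eq_iff_iff.2
      ⟨key w w' ν hν ν' hν' heq q, key w' w ν' hν' ν hν heq.symm q⟩

/-! ### Packing -/

/-- The ball in real dimension 2n has volume (πRn)ⁿ/n!, and nⁿ/n! ≤ eⁿ. -/
lemma volume_sum_norm_sq_le (n : ℕ) [NeZero n] {R : ℝ} (hR : 0 ≤ R) :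
    volume {x : Fin n → ℂ | ∑ t, ‖x t‖ ^ 2 ≤ R * n} ≤
      ENNReal.ofReal ((Real.pi * (R * Real.exp 1)) ^ n) := by
  have h := Complex.volume_sum_rpow_le (Fin n) (p := 2) one_le_two (√(R * n))
  have hset : {x : Fin n → ℂ | (∑ i, ‖x i‖ ^ (2 : ℝ)) ^ (1 / (2 : ℝ)) ≤ √(R * n)} =
      {x : Fin n → ℂ | ∑ t, ‖x t‖ ^ 2 ≤ R * n} := by
    ext x
    simp only [Set.mem_ofPred_eq, Real.rpow_two, ← Real.sqrt_eq_rpow]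
    exact Real.sqrt_le_sqrt_iff (by positivity)
  rw [hset] at h
  rw [h, ← ENNReal.ofReal_pow (by positivity), ← ENNReal.ofReal_mul (by positivity)]
  refine ENNReal.ofReal_le_ofReal ?_
  have hG1 : Real.Gamma (2 / 2 + 1) = 1 := by norm_num [Real.Gamma_two]
  have hG2 : Real.Gamma (2 * (Fintype.card (Fin n) : ℝ) / 2 + 1) = (n.factorial : ℝ) := by
    rw [Fintype.card_fin, mul_div_cancel_left₀ _ two_ne_zero, Real.Gamma_nat_eq_factorial]
  rw [hG1, hG2, Fintype.card_fin, pow_mul, Real.sq_sqrt (by positivity), mul_one]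
  have he := Real.pow_div_factorial_le_exp (x := n) (by positivity) n
  have : Real.exp n = Real.exp 1 ^ n := by rw [← Real.exp_nat_mul, mul_one]
  rw [this] at he
  calc (R * n) ^ n * (Real.pi ^ n / n.factorial)
      = Real.pi ^ n * R ^ n * ((n : ℝ) ^ n / n.factorial) := by rw [mul_pow]; ring
    _ ≤ Real.pi ^ n * R ^ n * Real.exp 1 ^ n := by gcongr
    _ = _ := by rw [mul_pow, mul_pow]; ring

lemma volume_norm_le (n : ℕ) {A : ℝ} (hA : 0 ≤ A) :
    volume {x : Fin n → ℂ | ∀ t, ‖x t‖ ^ 2 ≤ A} = ENNReal.ofReal ((Real.pi * A) ^ n) := by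
  have : {x : Fin n → ℂ | ∀ t, ‖x t‖ ^ 2 ≤ A} =
      Set.univ.pi fun _ => Metric.closedBall (0 : ℂ) (√A) := by
    ext x
    simp [Real.le_sqrt, hA]
  rw [this, volume_pi, Measure.pi_pi]
  simp only [Complex.volume_closedBall, Finset.prod_const, Finset.card_univ, Fintype.card_fin]
  rw [← ENNReal.ofReal_pow (by positivity), Real.sq_sqrt hA, mul_comm (Real.pi),
    ENNReal.ofReal_pow (by positivity), ENNReal.ofReal_mul hA, ← NNReal.coe_real_pi, ENNReal.ofReal_coe_nnreal]

/-- Greedy packing: as long as the translates of `B` do not cover `T`, a point can be added. -/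
lemma exists_packing {n : ℕ} {T B : Set (Fin n → ℂ)} (hneg : ∀ x ∈ B, -x ∈ B) (N : ℕ)
    (hN : ∀ m < N, m * volume B < volume T) :
    ∃ f : Fin N → Fin n → ℂ, (∀ i, f i ∈ T) ∧ ∀ i j, i ≠ j → f i - f j ∉ B := by
  induction N with
  | zero => exact ⟨Fin.elim0, fun i => i.elim0, fun i => i.elim0⟩
  | succ N ih =>
    obtain ⟨f, hT, hf⟩ := ih fun m hm => hN m (by omega)
    have hlt : volume (⋃ i, (fun x => x - f i) ⁻¹' B) < volume T := by
      refine (measure_iUnion_fintype_le _ _).trans_lt ?_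
      simp only [sub_eq_add_neg, measure_preimage_add_right, Finset.sum_const, Finset.card_univ,
        Fintype.card_fin, nsmul_eq_mul]
      exact hN N (by omega)
    obtain ⟨x, hxT, hx⟩ := Set.not_subset.1 fun hsub => (measure_mono hsub).not_gt hlt
    simp only [Set.mem_iUnion, Set.mem_preimage, not_exists] at hx
    refine ⟨Fin.cons x f, fun i => ?_, fun i j hij => ?_⟩
    · cases i using Fin.cases <;> simp [hxT, hT]
    · cases i using Fin.cases with
      | zero =>
        cases j using Fin.cases with
        | zero => exact absurd rfl hij
        | succ j => simpa using hx j
      | succ i =>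
        cases j using Fin.cases with
        | zero => exact fun h => hx i (by simpa using hneg _ h)
        | succ j => simpa using hf i j (by simpa using hij)

/-- A code with a packing of `2 ^ b` codewords, decoded correctly when the noise has squared
norm at most `2 n`. -/
lemma nonempty_packingCode {A : ℝ} (hA : 0 < A) {b n : ℕ} (hn : 0 < n)
    (hbn : (2 : ℝ) ^ b ≤ (A / (8 * Real.exp 1)) ^ n) :
    Nonempty (GaussianCode b n A
      (ENNReal.ofReal (Var[fun z : ℂ => ‖z‖ ^ 2; complexGaussian] / n))) := by
  have : NeZero n := ⟨hn.ne'⟩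
  have hn' : (0 : ℝ) < n := by exact_mod_cast hn
  -- Two noises of squared norm at most 2n differ by squared norm at most 8n, hence the excluded
  -- ball. Its volume is at most (8πe)ⁿ against (πA)ⁿ for the polydisc.
  obtain ⟨f, hf, hsep⟩ := exists_packing (n := n) (T := {x | ∀ t, ‖x t‖ ^ 2 ≤ A})
    (B := {x | ∑ t, ‖x t‖ ^ 2 ≤ 8 * n}) (by simp) (2 ^ b) (by
      intro m hm
      rw [volume_norm_le n hA.le]
      refine (mul_le_mul_right (volume_sum_norm_sq_le n (by norm_num)) _).trans_lt ?_
      rw [← ENNReal.ofReal_natCast, ← ENNReal.ofReal_mul (by positivity)]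
      refine (ENNReal.ofReal_lt_ofReal_iff (by positivity)).2 ?_
      have hm' : (m : ℝ) < 2 ^ b := by exact_mod_cast hm
      calc (m : ℝ) * (Real.pi * (8 * Real.exp 1)) ^ n
          < (A / (8 * Real.exp 1)) ^ n * (Real.pi * (8 * Real.exp 1)) ^ n := by
            gcongr; exact hm'.trans_le hbn
        _ = (Real.pi * A) ^ n := by
            rw [← mul_pow]; congr 1; field_simp)
  have e : (Fin b → Bool) ≃ Fin (2 ^ b) := Fintype.equivFinOfCardEq (by simp)
  set G : Set (Fin n → ℂ) := {ν | ∑ t, ‖ν t‖ ^ 2 ≤ 2 * n} with hG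
  refine nonempty_gaussianCode (fun w => f (e w)) (fun w => hf _) (G := G) ?_ ?_ ?_
  · exact measurableSet_le (by fun_prop) measurable_const
  -- The noise energy has mean n, so exceeding 2n is a deviation of n.
  · have h := gaussian_chebyshev (n := n) (X := fun _ z => ‖z‖ ^ 2) (fun _ => memLp_norm_sq)
      (μ := n) (V := n * Var[fun z : ℂ => ‖z‖ ^ 2; complexGaussian]) (c := n)
      (by simp [integral_norm_sq]) (by simp) hn'
    refine (measure_mono fun ν hν => ?_).trans
      (h.trans (ENNReal.ofReal_le_ofReal (le_of_eq ?_)))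
    · simp only [hG, Set.mem_compl_iff, Set.mem_ofPred_eq, not_le] at hν ⊢
      exact (by linarith : (n : ℝ) ≤ _).trans (le_abs_self _)
    · field_simp
  · intro w w' ν hν ν' hν' heq
    by_contra hne
    refine hsep (e w) (e w') (fun h => hne (e.injective h)) ?_
    have hd : f (e w) - f (e w') = ν' - ν := by
      rw [sub_eq_sub_iff_add_eq_add, heq]; abel
    simp only [hG, Set.mem_ofPred_eq] at hν hν' ⊢
    rw [hd]
    calc ∑ t, ‖(ν' - ν) t‖ ^ 2 ≤ ∑ t, (2 * ‖ν' t‖ ^ 2 + 2 * ‖ν t‖ ^ 2) := by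
          refine Finset.sum_le_sum fun t _ => ?_
          have := norm_sub_le (ν' t) (ν t)
          rw [Pi.sub_apply]
          nlinarith [norm_nonneg (ν' t - ν t), sq_nonneg (‖ν' t‖ - ‖ν t‖)]
      _ ≤ 8 * n := by
          rw [Finset.sum_add_distrib, ← Finset.mul_sum, ← Finset.mul_sum]
          linarith

/-- The number of symbols used to convey `b` bits with peak power `A`: a packing of rate
`log₂ (A / (8 e))` if that is at least `1`, and a repetition code otherwise. -/
noncomputable def codeLength (A : ℝ) (b : ℕ) : ℕ :=
  if 16 * Real.exp 1 ≤ A then ⌈(b : ℝ) / Real.logb 2 (A / (8 * Real.exp 1))⌉₊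
  else b * (b + 1) ^ 2

/-- Reliable codes of length `codeLength A b` exist for every peak power. -/
lemma exists_reliable_codes {A : ℝ} (hA : 0 < A) :
    ∃ δ : ℕ → ℝ≥0∞, Tendsto δ atTop (𝓝 0) ∧
      ∀ b, Nonempty (GaussianCode b (codeLength A b) A (δ b)) := by
  by_cases hcase : 16 * Real.exp 1 ≤ A
  · set R := Real.logb 2 (A / (8 * Real.exp 1)) with hR
    have hpos : 0 < A / (8 * Real.exp 1) := by positivity
    have hR1 : 1 ≤ R := by
      rw [hR, Real.le_logb_iff_rpow_le one_lt_two hpos, Real.rpow_one,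
        le_div_iff₀ (by positivity)]
      linarith
    set V := Var[fun z : ℂ => ‖z‖ ^ 2; complexGaussian]
    have hlen : ∀ b, codeLength A b = ⌈(b : ℝ) / R⌉₊ := fun b => if_pos hcase
    -- At `b = 0` the length is 0, which the packing code excludes; the value there does not affect
    -- the limit.
    refine ⟨fun b => if b = 0 then ⊤ else ENNReal.ofReal (V / codeLength A b), ?_, fun b => ?_⟩
    · have h1 : Tendsto (fun b : ℕ => (codeLength A b : ℝ)) atTop atTop := by
        simp only [hlen]
        refine tendsto_atTop_mono (fun b => Nat.le_ceil _) ?_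
        exact tendsto_natCast_atTop_atTop.atTop_div_const (by linarith)
      have h2 := ENNReal.tendsto_ofReal (tendsto_const_nhds (x := V).div_atTop h1)
      rw [ENNReal.ofReal_zero] at h2
      refine h2.congr' ?_
      filter_upwards [eventually_ne_atTop 0] with b hb
      rw [if_neg hb]
    · rcases Nat.eq_zero_or_pos b with rfl | hb
      · exact ⟨⟨fun _ _ => 0, fun _ => fun _ => false, measurable_const,
          fun _ _ => by simpa using hA.le, fun _ => by simp⟩⟩
      · simp only [if_neg hb.ne']
        have hb' : (0 : ℝ) < b := by exact_mod_cast hb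
        refine nonempty_packingCode hA ?_ ?_
        · rw [hlen]
          exact Nat.ceil_pos.2 (by positivity)
        · have h3 : (b : ℝ) ≤ R * codeLength A b := by
            rw [hlen, mul_comm, ← div_le_iff₀ (by linarith)]
            exact Nat.le_ceil _
          calc (2 : ℝ) ^ b = 2 ^ (b : ℝ) := (Real.rpow_natCast _ _).symm
            _ ≤ 2 ^ (R * codeLength A b) := Real.rpow_le_rpow_of_exponent_le one_le_two h3
            _ = _ := by
              rw [Real.rpow_mul zero_le_two, hR, Real.rpow_logb two_pos (by norm_num) hpos,
                Real.rpow_natCast]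
  -- With (b+1)² copies, the union bound over b bits is still O(1/b).
  · refine ⟨fun b => b * ENNReal.ofReal (1 / (2 * ((b + 1) ^ 2 : ℕ) * A)), ?_, fun b => ?_⟩
    · have h1 : Tendsto (fun b : ℕ => 1 / ((b : ℝ) + 1) * (1 / (2 * A))) atTop (𝓝 0) := by
        simpa using tendsto_one_div_add_atTop_nhds_zero_nat.mul_const (1 / (2 * A))
      have h2 := ENNReal.tendsto_ofReal h1
      rw [ENNReal.ofReal_zero] at h2
      refine tendsto_of_tendsto_of_tendsto_of_le_of_le tendsto_const_nhds h2
        (fun _ => zero_le) fun b => ?_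
      show (b : ℝ≥0∞) * _ ≤ _
      rw [← ENNReal.ofReal_natCast, ← ENNReal.ofReal_mul (by positivity)]
      refine ENNReal.ofReal_le_ofReal ?_
      push_cast
      rw [mul_one_div, one_div_mul_one_div, div_le_div_iff₀ (by positivity) (by positivity)]
      have hb : (0 : ℝ) ≤ b := by positivity
      nlinarith [mul_nonneg hb hA.le, mul_nonneg (mul_nonneg hb hb) hA.le]
    · rw [codeLength, if_neg hcase]
      exact nonempty_repetitionCode hA b (by positivity)

/-- The rate of the codes approaches `log₂ (A / (8 e))` as the block grows. -/
lemma tendsto_codeLength_div {A : ℝ} (hA : 16 * Real.exp 1 ≤ A) :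
    Tendsto (fun b : ℕ => (codeLength A b : ℝ) / b) atTop
      (𝓝 (Real.logb 2 (A / (8 * Real.exp 1)))⁻¹) := by
  have hR : 0 ≤ (Real.logb 2 (A / (8 * Real.exp 1)))⁻¹ := by
    refine inv_nonneg.2 (Real.logb_nonneg one_lt_two ?_)
    rw [le_div_iff₀ (by positivity)]
    linarith [Real.exp_pos 1]
  refine ((tendsto_nat_ceil_mul_div_atTop hR).comp
    tendsto_natCast_atTop_atTop).congr fun b => ?_
  rw [codeLength, if_pos hA, Function.comp_apply, div_eq_inv_mul (b : ℝ)]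

/-! ### The subfile code: cancellation of the cached interference -/

section SubfileCode

variable {K F S r L N b : ℕ} {A : Channel K L → ℝ} {δ : Channel K L → ℝ≥0∞} {n : Channel K L → ℕ}

/-- Whichever accessible cache is chosen, it holds the true subfile. -/
lemma readCache_place {C : Fin F → Fin K → Bool} {k : Fin K} {j : Fin F}
    (hj : ∃ i ∈ access K r k, j ∈ starRows C i) (W : Library N (F * b)) (i : Fin N) :
    readCache (r := r) (C := C) (k := k) (fun _ n j => subfile (W n) j) i j =
      subfile (W i) j := by
  obtain ⟨i, hi, hji⟩ := hj
  have : ∃ i : access K r k, j ∈ starRows C i := ⟨⟨i, hi⟩, hji⟩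
  rw [readCache, dif_pos this]

/-- The part of the signal of transmission `s` that user `k` can reconstruct from its caches. -/
noncomputable def cachedInterference {C : Fin F → Fin K → Bool}
    (D : Fin F → Fin K → Option (Fin S)) (v : Channel K L → Fin S → Fin K → Fin L → ℂ)
    (code : ∀ h, GaussianCode b (n h) (A h) (δ h)) (h : Channel K L) (d : Demand K N)
    (s : Fin S) (k : Fin K) (c : UserView r C N b k) : Fin (n h) → ℂ := fun t =>
  ∑ u, ∑ j, if D j u = some s ∧ u ≠ k ∧ D j k = none then
    (code h).enc (readCache c (d u) j) t * (h k ⬝ᵥ v h s u) else 0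

/-- The subfile code in which a user subtracts the cached interference and then decodes. -/
noncomputable def cancellingCode (C : Fin F → Fin K → Bool)
    (D : Fin F → Fin K → Option (Fin S)) (v : Channel K L → Fin S → Fin K → Fin L → ℂ)
    (code : ∀ h, GaussianCode b (n h) (A h) (δ h)) : SubfileCode r L S C N b where
  len := n
  enc := fun h => (code h).enc
  est := fun h d s k c y => (code h).dec (y - cachedInterference D v code h d s k c)
  measurable_est := fun h _ _ _ _ =>
    (code h).measurable_dec.comp (measurable_id.sub_const _)

variable {C : Fin F → Fin K → Bool} {D : Fin F → Fin K → Option (Fin S)}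
  {v : Channel K L → Fin S → Fin K → Fin L → ℂ} {code : ∀ h, GaussianCode b (n h) (A h) (δ h)}

/-- The noiseless signal of user `k` is the wanted codeword plus the cached interference. -/
lemma dotProduct_transmit (hD : IsDeliveryArray r L C D) {h : Channel K L}
    (hv : ∀ s j k, D j k = some s → h k ⬝ᵥ v h s k = 1 ∧
      ∀ u, u ≠ k → (∃ j', D j' u = some s) → D j u ≠ none → h u ⬝ᵥ v h s k = 0)
    (d : Demand K N) {s : Fin S} {j : Fin F} {k : Fin K} (hjk : D j k = some s)
    (W : Library N (F * b)) :
    (fun t => h k ⬝ᵥ (arrayScheme (r := r) (N := N) C D v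
        (cancellingCode C D v code)).transmit h d s W t) =
      (code h).enc (subfile (W (d k)) j) +
        cachedInterference (r := r) (C := C) D v code h d s k (fun _ n j => subfile (W n) j) := by
  funext (t : Fin (n h))
  change h k ⬝ᵥ (∑ u, ∑ j', if D j' u = some s then
      (code h).enc (subfile (W (d u)) j') t • v h s u else 0) = (code h).enc _ t +
    ∑ u, ∑ j', if D j' u = some s ∧ u ≠ k ∧ D j' k = none then
      (code h).enc (readCache (r := r) (C := C) (k := k) (fun _ n j => subfile (W n) j) (d u) j') t
        * (h k ⬝ᵥ v h s u) else 0
  simp only [dotProduct_sum]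
  have hone : (code h).enc (subfile (W (d k)) j) t = ∑ u, ∑ j',
      if u = k ∧ j' = j then (code h).enc (subfile (W (d k)) j) t else 0 := by
    simp [ite_and, Finset.sum_ite_eq']
  rw [hone, ← Finset.sum_add_distrib]
  refine Finset.sum_congr rfl fun u _ => ?_
  rw [← Finset.sum_add_distrib]
  refine Finset.sum_congr rfl fun j' _ => ?_
  -- Termwise comparison: for `u = k`, (D2) forces `j' = j` and the gain is 1; for `u ≠ k` the term
  -- is cached interference if `k` has `j'`, and is zero-forced otherwise.
  by_cases hs : D j' u = some s
  · rw [if_pos hs, dotProduct_smul, smul_eq_mul]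
    by_cases hu : u = k
    · subst hu
      obtain rfl := hD.once s u j j' hjk hs
      simp [(hv s j u hjk).1]
    · by_cases hn : D j' k = none
      · rw [if_neg (fun h => hu h.1), if_pos ⟨hs, hu, hn⟩, zero_add,
          readCache_place ((hD.star_iff j' k).1 hn)]
      · rw [(hv s j' u hs).2 k (Ne.symm hu) ⟨j, hjk⟩ hn, if_neg (fun h => hu h.1),
          if_neg (fun h => hn h.2.2)]
        simp
  · rw [if_neg hs, dotProduct_zero, if_neg (fun h => hs (by rw [h.1, h.2, hjk])),
      if_neg (fun h => hs h.1), zero_add]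

/-- User `k` recovers its file if none of the codes fails on its noise. -/
lemma decode_eq (hD : IsDeliveryArray r L C D) {H : Fin S → Channel K L}
    (hv : ∀ i s j k, D j k = some s → H i k ⬝ᵥ v (H i) s k = 1 ∧
      ∀ u, u ≠ k → (∃ j', D j' u = some s) → D j u ≠ none → H i u ⬝ᵥ v (H i) s k = 0)
    (d : Demand K N) (k : Fin K) (W : Library N (F * b)) (ν : ∀ s, Fin (n (H s)) → ℂ)
    (hν : ∀ j s, D j k = some s → (code (H s)).dec
      ((code (H s)).enc (subfile (W (d k)) j) + ν s) = subfile (W (d k)) j) :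
    (arrayScheme C D v (cancellingCode (r := r) (N := N) C D v code)).decode H d k
      (fun i => (arrayScheme C D v (cancellingCode (r := r) (N := N) C D v code)).place i W)
      ((arrayScheme C D v (cancellingCode (r := r) (N := N) C D v code)).received H d k W ν)
      = W (d k) := by
  funext p
  have hp : W (d k) p = subfile (W (d k)) (finProdFinEquiv.symm p).1 (finProdFinEquiv.symm p).2 :=
    congrArg (W (d k)) (finProdFinEquiv.apply_symm_apply p).symm
  rw [hp]
  cases hjk : D (finProdFinEquiv.symm p).1 k with
  | none =>
    simp only [arrayScheme, hjk]
    rw [readCache_place ((hD.star_iff _ k).1 hjk)]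
  | some s =>
    have hrec : (arrayScheme C D v
        (cancellingCode (r := r) (N := N) C D v code)).received H d k W ν s =
        (code (H s)).enc (subfile (W (d k)) (finProdFinEquiv.symm p).1) +
          cachedInterference (r := r) (C := C) D v code (H s) d s k
            (fun _ n j => subfile (W n) j) + ν s := by
      rw [← dotProduct_transmit hD (hv s) d hjk W]
      rfl
    rw [← hν _ s hjk]
    change (match D (finProdFinEquiv.symm p).1 k with
      | none => _
      | some s => _) = _
    rw [hjk]
    refine congrFun (congrArg (code (H s)).dec ?_) _
    rw [hrec, add_right_comm]
    exact add_sub_cancel_right _ _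

/-- The error probability of a user is at most the sum of those of the codes. -/
lemma errorProb_le (hD : IsDeliveryArray r L C D) {H : Fin S → Channel K L}
    (hv : ∀ i s j k, D j k = some s → H i k ⬝ᵥ v (H i) s k = 1 ∧
      ∀ u, u ≠ k → (∃ j', D j' u = some s) → D j u ≠ none → H i u ⬝ᵥ v (H i) s k = 0) :
    (arrayScheme C D v (cancellingCode (r := r) (N := N) C D v code)).errorProb H
      ≤ ∑ _j : Fin F, ∑ s, δ (H s) := by
  refine iSup_le fun d => iSup_le fun k => ?_
  refine ENNReal.div_le_of_le_mul ?_
  refine (Finset.sum_le_card_nsmul _ _ (∑ _j : Fin F, ∑ s, δ (H s)) fun W _ => ?_).trans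
    (by rw [nsmul_eq_mul, Finset.card_univ, mul_comm])
  set μ : Measure (∀ s, Fin (n (H s)) → ℂ) :=
    Measure.pi fun s => Measure.pi fun _ : Fin (n (H s)) => complexGaussian
  have hsub : {ν : ∀ s, Fin (n (H s)) → ℂ |
      (arrayScheme C D v (cancellingCode (r := r) (N := N) C D v code)).decode H d k
      (fun i => (arrayScheme C D v (cancellingCode (r := r) (N := N) C D v code)).place i W)
      ((arrayScheme C D v (cancellingCode (r := r) (N := N) C D v code)).received H d k W ν)
      ≠ W (d k)} ⊆ ⋃ j : Fin F, ⋃ s, (Function.eval s) ⁻¹'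
        {ν | (code (H s)).dec ((code (H s)).enc (subfile (W (d k)) j) + ν) ≠
          subfile (W (d k)) j} := by
    intro ν hν
    by_contra hcon
    refine hν (decode_eq hD hv d k W ν fun j s _ => ?_)
    by_contra hne
    exact hcon (Set.mem_iUnion.2 ⟨j, Set.mem_iUnion.2 ⟨s, hne⟩⟩)
  refine (measure_mono hsub).trans ((measure_iUnion_fintype_le _ _).trans ?_)
  refine Finset.sum_le_sum fun j _ => (measure_iUnion_fintype_le _ _).trans ?_
  refine Finset.sum_le_sum fun s _ => ?_
  refine le_trans (le_of_eq ?_) ((code (H s)).error_le (subfile (W (d k)) j))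
  -- The event involves only the noise of transmission `s`, so its marginal law suffices.
  refine (measurePreserving_eval (fun s => Measure.pi fun _ : Fin (n (H s)) => complexGaussian)
    s).measure_preimage (MeasurableSet.nullMeasurableSet ?_)
  have : Measurable fun ν => (code (H s)).dec ((code (H s)).enc (subfile (W (d k)) j) + ν) :=
    (code (H s)).measurable_dec.comp (measurable_const.add measurable_id)
  exact (this (MeasurableSet.singleton (subfile (W (d k)) j))).compl

end SubfileCode

/-! ### Memory, power and delivery time -/

/-- A cache holds `Z` subfiles of each file, so `N * Z * b` bits, which equals `M * F * b` as `M / N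
= Z / F`. -/
lemma meetsMemory_arrayScheme {K F Z r S L N b : ℕ} (hF : 0 < F) (hN : 0 < N)
    {C : Fin F → Fin K → Bool} (hC : IsCachingArray Z r C) (D : Fin F → Fin K → Option (Fin S))
    (v : Channel K L → Fin S → Fin K → Fin L → ℂ) (m : SubfileCode r L S C N b)
    {M : ℝ} (hM : M / (N : ℝ) = (Z : ℝ) / (F : ℝ)) :
    (arrayScheme C D v m).MeetsMemory M := by
  intro i
  have hF' : (F : ℝ) ≠ 0 := by exact_mod_cast hF.ne'
  have hN' : (N : ℝ) ≠ 0 := by exact_mod_cast hN.ne'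
  have hMB : M * ((F * b : ℕ) : ℝ) = ((N * (Z * b) : ℕ) : ℝ) := by
    rw [div_eq_div_iff hN' hF'] at hM
    push_cast
    linear_combination (b : ℝ) * hM
  have hcard : Nat.card (CacheContent C N b i) = 2 ^ (N * (Z * b)) := by
    rw [Nat.card_eq_fintype_card]
    simp only [Fintype.card_fun, Fintype.card_bool, Fintype.card_fin, Fintype.card_coe,
      hC.card_star i]
    rw [← pow_mul, ← pow_mul]
    congr 1
    ring
  have hle : (Set.range ((arrayScheme C D v m).place i)).ncard ≤ 2 ^ (N * (Z * b)) := by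
    rw [← hcard, ← Set.ncard_univ]
    exact Set.ncard_le_ncard (Set.subset_univ _) (Set.toFinite (α := CacheContent C N b i) _)
  have hpos : 0 < (Set.range ((arrayScheme C D v m).place i)).ncard := by
    refine (Set.ncard_pos (Set.toFinite (α := CacheContent C N b i) _)).2 ?_
    exact ⟨_, ⟨fun _ _ => false, rfl⟩⟩
  rw [hMB, Real.logb_le_iff_le_rpow one_lt_two (by exact_mod_cast hpos), Real.rpow_natCast]
  exact_mod_cast hle

/-- A constant such that the precoders turn symbols of squared modulus `A` into vectors of
squared norm at most `A` times that constant. -/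
noncomputable def precoderGain (F : ℕ) {K S L : ℕ}
    (v : Channel K L → Fin S → Fin K → Fin L → ℂ) (h : Channel K L) : ℝ :=
  -- The summand 1 keeps the constant positive, so that `P` can be divided by it; summing over `s`
  -- serves all transmissions at once.
  1 + ∑ s, ∑ a, (∑ k, ∑ _j : Fin F, ‖v h s k a‖) ^ 2

lemma precoderGain_pos (F : ℕ) {K S L : ℕ} (v : Channel K L → Fin S → Fin K → Fin L → ℂ)
    (h : Channel K L) : 0 < precoderGain F v h := by
  unfold precoderGain; positivity

lemma sum_norm_transmit_sq_le {K F S r L N b : ℕ} {C : Fin F → Fin K → Bool}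
    (D : Fin F → Fin K → Option (Fin S)) (v : Channel K L → Fin S → Fin K → Fin L → ℂ)
    (m : SubfileCode r L S C N b) {h : Channel K L} {A : ℝ} (hA : 0 ≤ A)
    (hm : ∀ w t, ‖m.enc h w t‖ ^ 2 ≤ A) (d : Demand K N) (s : Fin S) (W : Library N (F * b))
    (t : Fin (m.len h)) :
    ∑ a, ‖(arrayScheme C D v m).transmit h d s W t a‖ ^ 2 ≤ A * precoderGain F v h := by
  have h1 : ∀ a, ‖(arrayScheme C D v m).transmit h d s W t a‖ ^ 2 ≤
      A * (∑ k, ∑ _j : Fin F, ‖v h s k a‖) ^ 2 := by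
    intro a
    have h2 : ‖(arrayScheme C D v m).transmit h d s W t a‖ ≤
        √A * ∑ k, ∑ _j : Fin F, ‖v h s k a‖ := by
      simp only [arrayScheme, Finset.sum_apply, Finset.mul_sum]
      refine (norm_sum_le _ _).trans (Finset.sum_le_sum fun k _ => ?_)
      refine (norm_sum_le _ _).trans (Finset.sum_le_sum fun j _ => ?_)
      split_ifs
      · rw [Pi.smul_apply, norm_smul]
        gcongr
        exact Real.le_sqrt_of_sq_le (hm _ _)
      · simp only [Pi.zero_apply, norm_zero]
        positivity
    calc _ ≤ (√A * ∑ k, ∑ _j : Fin F, ‖v h s k a‖) ^ 2 := by gcongr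
      _ = _ := by rw [mul_pow, Real.sq_sqrt hA]
  refine (Finset.sum_le_sum fun a _ => h1 a).trans ?_
  rw [← Finset.mul_sum]
  refine mul_le_mul_of_nonneg_left ?_ hA
  have h3 := Finset.single_le_sum (f := fun s => ∑ a, (∑ k, ∑ _j : Fin F, ‖v h s k a‖) ^ 2)
    (fun s _ => by positivity) (Finset.mem_univ s)
  unfold precoderGain
  linarith

/-- A constant power factor, here from 8e and the precoders, disappears at logarithmic scale. -/
lemma tendsto_logb_div_logb_mul {c : ℝ} (hc : 0 < c) :
    Tendsto (fun P => Real.logb 2 P / Real.logb 2 (P * c)) atTop (𝓝 1) := by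
  have h1 : Tendsto (fun P => 1 + Real.logb 2 c / Real.logb 2 P) atTop (𝓝 (1 + 0)) :=
    tendsto_const_nhds.add (tendsto_const_nhds.div_atTop (Real.tendsto_logb_atTop one_lt_two))
  rw [add_zero] at h1
  have h2 := h1.inv₀ one_ne_zero
  rw [inv_one] at h2
  refine h2.congr' ?_
  filter_upwards [eventually_gt_atTop 1] with P hP
  have h3 : 0 < Real.logb 2 P := Real.logb_pos one_lt_two hP
  rw [Real.logb_mul (by positivity) hc.ne', ← inv_div]
  field_simp

lemma deliveryTime_arrayScheme {K F S r L N b : ℕ} (hN : 0 < N) {C : Fin F → Fin K → Bool}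
    (D : Fin F → Fin K → Option (Fin S)) (v : Channel K L → Fin S → Fin K → Fin L → ℂ)
    (m : SubfileCode r L S C N b) (H : Fin S → Channel K L) :
    (arrayScheme C D v m).deliveryTime H = ∑ s, m.len (H s) := by
  have : Nonempty (Demand K N) := ⟨fun _ => ⟨0, hN⟩⟩
  change (Finset.univ.sup fun _ : Demand K N => ∑ s, m.len (H s)) = _
  rw [Finset.sup_const Finset.univ_nonempty]

lemma hasNDT_arrayScheme {K F S r L N : ℕ} (hF : 0 < F) (hN : 0 < N) {C : Fin F → Fin K → Bool}
    (D : Fin F → Fin K → Option (Fin S)) (v : Channel K L → Fin S → Fin K → Fin L → ℂ)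
    (m : ℝ → ∀ b, SubfileCode r L S C N b) (H : Fin S → Channel K L) {κ : Fin S → ℝ}
    (hκ : ∀ s, 0 < κ s)
    (hm : ∀ P, 0 < P → ∀ b s, (m P b).len (H s) = codeLength (P / κ s) b) :
    HasNDT (fun P b => arrayScheme C D v (m P b)) H ((S : ℝ) / (F : ℝ)) := by
  have hF' : (F : ℝ) ≠ 0 := by exact_mod_cast hF.ne'
  refine ⟨fun P => ∑ s, Real.logb 2 P / Real.logb 2 (P * (κ s * (8 * Real.exp 1))⁻¹) / F,
    ?_, ?_⟩
  · have hev : ∀ᶠ P : ℝ in atTop, ∀ s, 16 * Real.exp 1 ≤ P / κ s :=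
      -- For a fixed realization `H`, large `P` puts every transmission in the packing regime.
      eventually_all.2 fun s => (tendsto_id.atTop_div_const (hκ s)).eventually_ge_atTop _
    filter_upwards [hev, eventually_gt_atTop 0] with P hP hP0
    have h1 : Tendsto (fun b : ℕ => ∑ s, (codeLength (P / κ s) b : ℝ) / b *
        (Real.logb 2 P / F)) atTop
        (𝓝 (∑ s, (Real.logb 2 (P / κ s / (8 * Real.exp 1)))⁻¹ * (Real.logb 2 P / F))) :=
      tendsto_finsetSum _ fun s _ => (tendsto_codeLength_div (hP s)).mul_const _
    convert! h1.congr' ?_ using 2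
    · refine Finset.sum_congr rfl fun s _ => ?_
      rw [div_div P, ← div_eq_mul_inv P]
      ring
    · filter_upwards with b
      rw [deliveryTime_arrayScheme hN, Nat.cast_sum, Finset.sum_div]
      refine Finset.sum_congr rfl fun s _ => ?_
      rw [hm P hP0, div_div_eq_mul_div, Nat.cast_mul, div_mul_div_comm, mul_comm (b : ℝ)]
  · have h2 : Tendsto (fun P => ∑ s, Real.logb 2 P /
        Real.logb 2 (P * (κ s * (8 * Real.exp 1))⁻¹) / F) atTop
        (𝓝 (∑ _s : Fin S, 1 / (F : ℝ))) :=
      tendsto_finsetSum _ fun s _ => (tendsto_logb_div_logb_mul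
        (inv_pos.2 (mul_pos (hκ s) (by positivity)))).div_const _
    simpa [div_eq_mul_inv] using h2

end MACC


theorem lemma1 {K F Z r S L N : ℕ} (hK : 0 < K) (hF : 0 < F) (hZ : 0 < Z) (hr : 0 < r)
    (hS : 0 < S) (hL : 0 < L) (hN : 0 < N) (hrK : r ≤ K)
    (C : Fin F → Fin K → Bool) (hC : IsCachingArray Z r C)
    (D : Fin F → Fin K → Option (Fin S)) (hD : IsDeliveryArray r L C D)
    (M : ℝ) (hM : M / (N : ℝ) = (Z : ℝ) / (F : ℝ)) :
    (∀ᵐ h : Channel K L, GeneralPosition h) ∧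
    ∃ (v : Channel K L → Fin S → Fin K → Fin L → ℂ)
      (m : ℝ → ∀ b : ℕ, SubfileCode r L S C N b),
      IsZeroForcing D v ∧
      (∀ P b, (arrayScheme C D v (m P b)).MeetsMemory M) ∧
      ∀ H : Fin S → Channel K L, (∀ s, GeneralPosition (H s)) →
        (∀ P : ℝ, 0 < P →
          (∀ b, (arrayScheme C D v (m P b)).MeetsPower P H) ∧
          Tendsto (fun b => (arrayScheme C D v (m P b)).errorProb H) atTop (𝓝 0)) ∧
        HasNDT (fun P b => arrayScheme C D v (m P b)) H ((S : ℝ) / (F : ℝ)) := by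

  refine ⟨ae_generalPosition K L, ?_⟩
  obtain ⟨v, hv⟩ := exists_unit_gain_precoder hD
  -- Peak symbol power that keeps the precoded vector within `P`; the value 1 only makes codes
  -- available for `P ≤ 0`.
  set amp : ℝ → Channel K L → ℝ := fun P h => if 0 < P then P / precoderGain F v h else 1
    with hamp
  have hamp_pos : ∀ P h, 0 < amp P h := by
    intro P h
    simp only [hamp]
    split_ifs with hP
    · exact div_pos hP (precoderGain_pos F v h)
    · exact one_pos
  choose δ hδ code using fun P h => exists_reliable_codes (hamp_pos P h)
  set m : ℝ → ∀ b : ℕ, SubfileCode r L S C N b := fun P b =>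
    cancellingCode C D v fun h => (code P h b).some with hm
  refine ⟨v, m, fun h hh s j k hjk => ?_, fun P b => meetsMemory_arrayScheme hF hN hC D v _ hM,
    fun H hH => ⟨fun P hP => ⟨fun b d s t => ?_, ?_⟩, ?_⟩⟩
  · obtain ⟨h1, h2⟩ := hv h hh s j k hjk
    exact ⟨h2, h1 ▸ one_ne_zero⟩
  · have hle : ∀ W : Library N (F * b),
        ∑ a, ‖(arrayScheme C D v (m P b)).transmit (H s) d s W t a‖ ^ 2 ≤ P := by
      intro W
      refine (sum_norm_transmit_sq_le D v (m P b) (hamp_pos P (H s)).le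
        (code P (H s) b).some.norm_sq_le d s W t).trans (le_of_eq ?_)
      simp only [hamp, if_pos hP]
      exact div_mul_cancel₀ _ (precoderGain_pos F v _).ne'
    have hcard : (0 : ℝ) < Fintype.card (Library N (F * b)) := by
      exact_mod_cast Fintype.card_pos
    rw [div_le_iff₀ hcard]
    refine (Finset.sum_le_sum fun W _ => hle W).trans (le_of_eq ?_)
    rw [Finset.sum_const, Finset.card_univ, nsmul_eq_mul, mul_comm]
  · have hlim : Tendsto (fun b => ∑ _j : Fin F, ∑ s, δ P (H s) b) atTop
        (𝓝 (∑ _j : Fin F, ∑ _s : Fin S, 0)) :=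
      tendsto_finsetSum _ fun _ _ => tendsto_finsetSum _ fun s _ => hδ P (H s)
    simp only [Finset.sum_const_zero] at hlim
    exact tendsto_of_tendsto_of_tendsto_of_le_of_le tendsto_const_nhds hlim
      (fun _ => zero_le) fun b => errorProb_le hD fun i => hv (H i) (hH i)
  · refine hasNDT_arrayScheme hF hN D v m H (fun s => precoderGain_pos F v (H s)) ?_
    intro P hP b s
    simp only [hm, cancellingCode, hamp, if_pos hP]
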